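/- A \emph{section} of a group $G$ is a homomorphic image of a subgroup of $G$. A \emph{variety} of groups is the class of all groups satisfying some set of laws; the variety \emph{generated} by a set $\mathfrak{X}$ of groups is the smallest variety containing $\mathfrak{X}$. A variety is \emph{locally finite} if every finitely generated group in it is finite. Let $p$ and $q$ be distinct primes and let $D=A\rtimes B$ be a semidirect product of its subgroups $A$ and $B$ (with $A$ normal in $D$) such that $A$ is a cyclic $p$-group, $B$ is a cyclic group of order $q$, and $[A,B]\neq 1$. (i) Let $\mathfrak{L}$ be a locally finite variety generated by a set $\mathfrak{X}$ of groups. If $D$ lies in $\mathfrak{L}$, then $D$ is a section of a group from $\mathfrak{X}$. (ii) In particular, if $\mathfrak{X}$ consists of a finite number of finite groups and $D$ belongs to the variety generated by $\mathfrak{X}$, then $D$ is a section of a group from $\mathfrak{X}$. -/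

import Mathlib

universe u

/-- `D` is a section of `G`: a homomorphic image of a subgroup of `G`. -/
def IsGroupSection (D G : Type*) [Group D] [Group G] : Prop :=
  ∃ (H : Subgroup G) (f : H →* D), Function.Surjective f

/-- The word `w` in the variables indexed by `ℕ` is a law of `G`: it takes the value `1` under
every substitution of elements of `G` for the variables. -/
def IsGroupLaw (w : FreeGroup ℕ) (G : Type*) [Group G] : Prop :=
  ∀ x : ℕ → G, FreeGroup.lift x w = 1

/-- A class of groups is a variety if it consists of all groups satisfying some set of laws. -/
def IsGroupVariety (𝔙 : Set GrpCat.{u}) : Prop :=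
  ∃ W : Set (FreeGroup ℕ), 𝔙 = {G : GrpCat.{u} | ∀ w ∈ W, IsGroupLaw w G}

/-- The variety generated by a set of groups: the smallest variety containing it. -/
def generatedGroupVariety (𝔛 : Set GrpCat.{u}) : Set GrpCat.{u} :=
  ⋂₀ {𝔙 : Set GrpCat.{u} | IsGroupVariety 𝔙 ∧ 𝔛 ⊆ 𝔙}

/-- The intersection of the varieties containing `𝔛` is itself a variety containing `𝔛`. -/
theorem isLeast_generatedGroupVariety (𝔛 : Set GrpCat.{u}) :
    IsLeast {𝔙 : Set GrpCat.{u} | IsGroupVariety 𝔙 ∧ 𝔛 ⊆ 𝔙} (generatedGroupVariety 𝔛) := by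
  refine ⟨⟨⟨{w | ∀ X ∈ 𝔛, IsGroupLaw w X}, ?_⟩, ?_⟩, fun 𝔙 h => Set.sInter_subset_of_mem h⟩
  · apply Set.Subset.antisymm
    · exact Set.sInter_subset_of_mem ⟨⟨_, rfl⟩, fun X hX w hw => hw X hX⟩
    · rintro G hG 𝔙 ⟨⟨W, rfl⟩, h⟩ w hw
      exact hG w fun X hX => h hX w hw
  · exact fun X hX 𝔙 h => h.2 hX

/-- Every finitely generated group in the class is finite. -/
def IsLocallyFiniteGroupClass (𝔙 : Set GrpCat.{u}) : Prop :=
  ∀ G ∈ 𝔙, Group.FG G → Finite G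

/-!
The free group `K` on the set `D` in the variety generated by `𝔛` is the quotient of the free group
by its verbal kernel, the intersection of the kernels of all homomorphisms to members of `𝔛`. It maps
onto `D`, homomorphisms to members of `𝔛` separate its elements, and it is finite in both cases: by
local finiteness, or because it embeds in a finite product of finite groups. It remains to find `D`
as a section of one of the members (`exists_isGroupSection_of_separating`).

For this, one finds in `K` a cyclic `p`-subgroup `⟨x⟩` mapping onto `A` and an element `b` of
`q`-power order that normalizes `⟨x⟩` and maps outside `A` (`exists_normalizer_zpowers_map_eq`).
Frattini's argument gives a `p`-subgroup `P` mapping onto `A` and normalized by such a `b`. In the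
abelianization of `P`, averaging over the coprime action of `b` produces an eigenvector `w` whose
image generates `A`. Either `P` is generated by `w`, or the proper invariant subgroup `⟨w⟩P'` can take
the place of `P`, and induction applies (`IsPGroup.exists_map_mem_zpowers`).

Some homomorphism `φ` from `K` to a member `X` of `𝔛` does not kill the subgroup of order `p` of `⟨x⟩`
and is therefore injective on `⟨x⟩`. An element of `⟨x, b⟩` in the kernel of `φ` commutes with `x` and
has `q`-power order. Its image in `D` centralizes `A`, hence lies in the `p`-group `A`, and is trivial.
So the surjection from `⟨x, b⟩` to `D` factors through the image of `φ`, a subgroup of `X`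
(`isGroupSection_of_zpowers_disjoint_ker`).
-/

/-! ### Lifting exponents modulo prime powers -/

/-- An element `c` of multiplicative order dividing `N` modulo a multiple of `p` lifts to such an
element modulo every power of `p`, as with Teichmüller representatives. -/
theorem Nat.exists_modEq_pow_modEq_one {p N m c : ℕ} (hN : N.Coprime p)
    (hN0 : N ≠ 0) (hp : p ∣ m) (hc : c ^ N ≡ 1 [MOD m]) (e : ℕ) :
    ∃ l : ℕ, l ≡ c [MOD m] ∧ l ^ N ≡ 1 [MOD p ^ e] := by
  obtain ⟨k, hek, hk⟩ : ∃ k, e ≤ k ∧ p ^ k ≡ 1 [MOD N] := by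
    refine ⟨N.totient * e, Nat.le_mul_of_pos_left e (Nat.totient_pos.2 (Nat.pos_of_ne_zero hN0)), ?_⟩
    rw [pow_mul]
    simpa using (Nat.ModEq.pow_totient hN.symm).pow e
  -- Since `p ^ k ≡ 1` modulo `N`, raising to this power fixes `c`, while it turns a congruence
  -- modulo `p` into one modulo `p ^ (k + 1)`.
  refine ⟨c ^ p ^ k, ?_, ?_⟩
  · rcases Nat.eq_zero_or_pos (p ^ k) with h0 | h0
    · rw [h0] at hk ⊢
      have : N = 1 := by simpa [Nat.modEq_zero_iff_dvd] using hk.symm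
      subst this
      simpa using hc.symm
    · obtain ⟨t, ht⟩ := (Nat.modEq_iff_dvd' h0).1 hk.symm
      have : p ^ k = N * t + 1 := by omega
      rw [this, pow_succ, pow_mul]
      simpa using (hc.pow t).mul_right c
  · have h1 : (p : ℤ) ∣ (c : ℤ) ^ N - 1 := by
      have := ((Nat.modEq_iff_dvd.1 (hc.of_dvd hp).symm))
      simpa using this
    have h2 := dvd_sub_pow_of_dvd_sub h1 k
    rw [one_pow, ← pow_mul, mul_comm, pow_mul] at h2
    refine (Nat.modEq_iff_dvd.2 ?_).symm
    push_cast
    exact (pow_dvd_pow _ (by omega)).trans h2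

/-! ### Invariant cyclic subgroups under coprime action -/

/-- A finite nilpotent group is generated by any element whose image generates the abelianization,
because every maximal subgroup is normal with abelian quotient. -/
theorem Subgroup.zpowers_eq_top_of_zpowers_abelianization_eq_top {P : Type*} [Group P] [Finite P]
    [Group.IsNilpotent P] {w : P} (h : zpowers (Abelianization.of w) = ⊤) : zpowers w = ⊤ := by
  by_contra hw
  obtain ⟨M, hM, hwM⟩ := (eq_top_or_exists_le_coatom (zpowers w)).resolve_left hw
  have hMn : M.Normal := Subgroup.NormalizerCondition.normal_of_coatom M
    Group.normalizerCondition_of_isNilpotent hM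
  have hcomm : _root_.commutator P ≤ M := by
    rw [← Subgroup.Normal.quotient_commutative_iff_commutator_le]
    have hnt : Nontrivial (P ⧸ M) := QuotientGroup.nontrivial_iff.2 hM.1
    have hc : Subgroup.center (P ⧸ M) = ⊤ := by
      have hle : M ≤ (Subgroup.center (P ⧸ M)).comap (QuotientGroup.mk' M) := fun x hx => by
        rw [Subgroup.mem_comap, QuotientGroup.mk'_apply, (QuotientGroup.eq_one_iff x).2 hx]
        exact one_mem _
      rcases hle.eq_or_lt with heq | hlt
      · exfalso
        refine Group.IsNilpotent.center_ne_bot (G := P ⧸ M) ?_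
        rw [← Subgroup.map_comap_eq_self_of_surjective (QuotientGroup.mk'_surjective M)
          (Subgroup.center (P ⧸ M)), ← heq, QuotientGroup.map_mk'_self]
      · have := hM.2 _ hlt
        rw [← Subgroup.comap_top (QuotientGroup.mk' M)] at this
        exact Subgroup.comap_injective (QuotientGroup.mk'_surjective M) this
    exact ⟨⟨fun a b => Subgroup.mem_center_iff.1 (hc ▸ mem_top b) a⟩⟩
  refine hM.1 (eq_top_iff.2 fun g _ => ?_)
  obtain ⟨k, hk⟩ := mem_zpowers_iff.1 (h ▸ mem_top (Abelianization.of g))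
  have h1 : w ^ (-k) * g ∈ _root_.commutator P := by
    rw [← Abelianization.ker_of, MonoidHom.mem_ker, map_mul, map_zpow, ← hk, ← zpow_add]
    simp
  have h2 := mul_mem (zpow_mem (hwM (mem_zpowers w)) k) (hcomm h1)
  simpa using h2

/-- Projection onto an eigenspace, as in Maschke's theorem: an operator `τ` with `τ ^ N = 1` on an
abelian group has an eigenvector of eigenvalue `l` whose image under an equivariant map `ρ` to a
group on which the operator acts as the scalar `l` is `ρ u ^ (N * l ^ (N - 1))`. -/
theorem exists_map_eq_pow_of_commGroup {E A : Type*} [CommGroup E] [CommGroup A] (τ : E →* E)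
    (ρ : E →* A) {N l : ℕ} (hτ : ∀ u, τ^[N] u = u) (hl : ∀ u : E, u ^ l ^ N = u)
    (hρ : ∀ u, ρ (τ u) = ρ u ^ l) (u : E) :
    ∃ y, τ y = y ^ l ∧ ρ y = ρ u ^ (N * l ^ (N - 1)) := by
  -- Up to a power of `l`, this is the sum of `l⁻ⁱ τⁱ u` over `i < N`, in additive notation; the
  -- exponents are arranged to avoid inverting `l`.
  refine ⟨∏ i ∈ Finset.range N, (τ^[i] u) ^ l ^ (N - 1 - i), ?_, ?_⟩
  · have h1 := Finset.prod_range_succ (fun i => (τ^[i] u) ^ l ^ (N - i)) N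
    rw [Finset.prod_range_succ'] at h1
    simp only [Function.iterate_zero, id, Nat.sub_zero, Nat.sub_self, pow_zero, pow_one, hτ, hl] at h1
    have h2 := mul_right_cancel h1
    rw [map_prod, ← Finset.prod_pow]
    refine Eq.trans ?_ (h2.trans ?_)
    · refine Finset.prod_congr rfl fun i hi => ?_
      rw [map_pow, ← Function.iterate_succ_apply' τ, Nat.sub_sub, add_comm 1]
    · refine Finset.prod_congr rfl fun i hi => ?_
      rw [← pow_mul, ← pow_succ]
      congr 2
      have := Finset.mem_range.1 hi
      omega
  · have h : ∀ i, ρ (τ^[i] u) = ρ u ^ l ^ i := by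
      intro i
      induction i with
      | zero => simp
      | succ i ih => rw [Function.iterate_succ_apply', hρ, ih, ← pow_mul, ← pow_succ]
    rw [map_prod, Finset.prod_congr rfl (g := fun _ => ρ u ^ l ^ (N - 1))]
    · rw [Finset.prod_const, Finset.card_range, ← pow_mul, mul_comm]
    · intro i hi
      rw [map_pow, h, ← pow_mul, ← pow_add]
      congr 2
      have := Finset.mem_range.1 hi
      omega

theorem Subgroup.zpowers_pow_eq_of_coprime {G : Type*} [Group G] {g : G} {n : ℕ}
    (h : (orderOf g).Coprime n) : zpowers (g ^ n) = zpowers g := by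
  apply le_antisymm (zpowers_le.2 (pow_mem (mem_zpowers g) n))
  obtain ⟨m, hm⟩ := exists_pow_eq_self_of_coprime h.symm
  exact zpowers_le.2 (mem_zpowers_iff.2 ⟨m, by rw [zpow_natCast, hm]⟩)

/-- Let `σ` be an endomorphism with `σ ^ N = 1` of a finite `p`-group `P`, where `p ∤ N`, and let `ρ`
map `P` to a cyclic group on which `σ` induces the `l`-th power map. If some element of `P` maps to
a generator, then so does one that generates a `σ`-invariant cyclic subgroup. -/
theorem IsPGroup.exists_map_mem_zpowers {p N l e : ℕ} [Fact p.Prime] (hN : N.Coprime p)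
    (he : e ≠ 0) (hl : l ^ N ≡ 1 [MOD p ^ e]) {A : Type*} [CommGroup A] {P : Type*} [Group P]
    [Finite P] (σ : P →* P) (ρ : P →* A) (hP : ∀ u : P, u ^ p ^ e = 1) (hσ : ∀ u, σ^[N] u = u)
    (hρ : ∀ u, ρ (σ u) = ρ u ^ l) {u : P} (hu : Subgroup.zpowers (ρ u) = ⊤) :
    ∃ w, σ w ∈ Subgroup.zpowers w ∧ Subgroup.zpowers (ρ w) = ⊤ := by
  induction hn : Nat.card P using Nat.strong_induction_on generalizing P with | _ n ih
  have hpP : IsPGroup p P := fun g => ⟨e, hP g⟩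
  have hnil : Group.IsNilpotent P := hpP.isNilpotent
  have hof : Function.Surjective (Abelianization.of (G := P)) := QuotientGroup.mk_surjective
  have hpow : ∀ u : Abelianization P, u ^ l ^ N = u := by
    intro v
    obtain ⟨u, rfl⟩ := hof v
    rw [← map_pow]
    congr 1
    conv_rhs => rw [← pow_one u]
    rw [pow_eq_pow_iff_modEq]
    exact hl.of_dvd (orderOf_dvd_of_pow_eq_one (hP u))
  have hiter : ∀ (i : ℕ) (u : P), (Abelianization.map σ)^[i] (Abelianization.of u) =
      Abelianization.of (σ^[i] u) := by
    intro i
    induction i with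
    | zero => intro u; rfl
    | succ i ih => intro u; rw [Function.iterate_succ_apply, Abelianization.map_of, ih]; rfl
  obtain ⟨y, hy, hyu⟩ := exists_map_eq_pow_of_commGroup (Abelianization.map σ)
    (Abelianization.lift ρ) (N := N) (l := l)
    (fun v => by
      obtain ⟨u, rfl⟩ := hof v
      rw [hiter, hσ]) hpow
    (fun v => by
      obtain ⟨u, rfl⟩ := hof v
      simpa using hρ u) (Abelianization.of u)
  obtain ⟨w, rfl⟩ := hof y
  rw [Abelianization.lift_apply_of, Abelianization.lift_apply_of] at hyu
  have hcop : (orderOf (ρ u)).Coprime (N * l ^ (N - 1)) := by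
    have h1 : orderOf (ρ u) ∣ p ^ e := orderOf_dvd_of_pow_eq_one (by rw [← map_pow, hP, map_one])
    refine Nat.Coprime.coprime_dvd_left h1 (Nat.Coprime.pow_left _ ?_)
    refine Nat.Coprime.mul_right hN.symm ?_
    rcases Nat.eq_zero_or_pos N with rfl | hN0
    · simp
    refine Nat.Coprime.pow_right _ ?_
    rw [Nat.Prime.coprime_iff_not_dvd Fact.out]
    intro hd
    have h2 := (hl.of_dvd (dvd_pow_self p he)).symm.trans
      (Nat.modEq_zero_iff_dvd.2 (hd.trans (dvd_pow_self l hN0.ne')))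
    exact (Fact.out : p.Prime).one_lt.ne' (Nat.dvd_one.1 (Nat.modEq_zero_iff_dvd.1 h2))
  have hw : Subgroup.zpowers (ρ w) = ⊤ := by
    rw [hyu, Subgroup.zpowers_pow_eq_of_coprime hcop, hu]
  -- The preimage `⟨w⟩P'` of the subgroup generated by the eigenvector is invariant under `σ`. Either
  -- it is all of `P`, which is then cyclic, or it is a smaller group to which induction applies.
  let Q : Subgroup P := (Subgroup.zpowers (Abelianization.of w)).comap Abelianization.of
  have hQσ : ∀ g ∈ Q, σ g ∈ Q := by
    rintro g ⟨k, hk⟩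
    refine ⟨l * k, ?_⟩
    simp only at hk ⊢
    rw [← Abelianization.map_of, ← hk, map_zpow, hy, zpow_mul, zpow_natCast]
  by_cases hQ : Q = ⊤
  · have : Subgroup.zpowers w = ⊤ := by
      apply Subgroup.zpowers_eq_top_of_zpowers_abelianization_eq_top
      rw [← Subgroup.comap_top Abelianization.of] at hQ
      exact Subgroup.comap_injective hof hQ
    exact ⟨w, this ▸ Subgroup.mem_top _, hw⟩
  · have hlt : Nat.card Q < n := by
      rw [← hn]
      exact lt_of_le_of_ne (Subgroup.card_le_card_group Q) fun h => hQ (Subgroup.eq_top_of_card_eq Q h)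
    let σQ : Q →* Q := (σ.comp Q.subtype).codRestrict Q fun g => hQσ g g.2
    have hσQ : ∀ (i : ℕ) (g : Q), ((σQ^[i] g : Q) : P) = σ^[i] g := by
      intro i
      induction i with
      | zero => intro g; rfl
      | succ i ih => intro g; rw [Function.iterate_succ_apply, ih]; rfl
    obtain ⟨v, ⟨k, hv⟩, hv'⟩ := ih _ hlt σQ (ρ.comp Q.subtype) (fun g => Subtype.ext (hP g))
      (fun g => Subtype.ext (by rw [hσQ, hσ])) (fun g => hρ g)
      (u := ⟨w, Subgroup.mem_zpowers _⟩) hw rfl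
    exact ⟨v, ⟨k, congrArg Subtype.val hv⟩, hv'⟩

/-! ### Cyclic-by-cyclic subgroups covering `D` -/

/-- If `α : L →* X` separates at least as much as a surjection `L →* D`, then `D` is a quotient of the
range of `α`. -/
theorem IsGroupSection.of_ker_le {D X L : Type*} [Group D] [Group X] [Group L] (α : L →* X)
    (β : L →* D) (hβ : Function.Surjective β) (h : α.ker ≤ β.ker) : IsGroupSection D X := by
  refine ⟨α.range, (QuotientGroup.lift α.ker β h).comp
    (QuotientGroup.quotientKerEquivRange α).symm.toMonoidHom, fun d => ?_⟩
  obtain ⟨x, rfl⟩ := hβ d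
  exact ⟨QuotientGroup.quotientKerEquivRange α x, by simp⟩

section

variable {D : Type*} [Group D] {A : Subgroup D} {p q : ℕ}

theorem Subgroup.eq_top_of_lt_of_prime_index (hq : A.index.Prime) {H : Subgroup D} (h : A < H) :
    H = ⊤ := by
  have h1 := Subgroup.relIndex_mul_index h.le
  rcases (Nat.dvd_prime hq).1 (Dvd.intro_left _ h1) with h2 | h2
  · exact Subgroup.index_eq_one.1 h2
  · rw [h2] at h1
    exact absurd (Subgroup.relIndex_eq_one.1 ((Nat.mul_eq_right hq.ne_zero).1 h1)) h.not_ge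

theorem Subgroup.centralizer_le_of_prime_index (hq : A.index.Prime) (hA : IsMulCommutative A)
    (hc : ¬ A ≤ center D) : centralizer (A : Set D) ≤ A := by
  intro c hcc
  by_contra hcA
  have hle : A ≤ centralizer A := le_centralizer A
  have := Subgroup.eq_top_of_lt_of_prime_index hq (lt_of_le_of_ne hle fun h => hcA (h ▸ hcc))
  exact hc (centralizer_eq_top_iff_subset.1 this)

/-- An element outside the preimage of a normal subgroup of prime index `q` can be replaced by a power
of it that is still outside and has `q`-power order. -/
theorem exists_pow_prime_pow_eq_one_of_notMem {K : Type*} [Group K] [Finite K] [A.Normal]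
    (hq : q.Prime) (hi : A.index = q) (π : K →* D) {S : Subgroup K} {b : K} (hb : b ∈ S)
    (hbA : π b ∉ A) : ∃ b' ∈ S, π b' ∉ A ∧ ∃ s, b' ^ q ^ s = 1 := by
  obtain ⟨s, m, hm, hs⟩ := Nat.exists_eq_pow_mul_and_not_dvd (orderOf_pos b).ne' q hq.ne_one
  refine ⟨b ^ m, pow_mem hb m, fun h => hbA ?_, s, ?_⟩
  · have h1 : (π b : D ⧸ A) ^ m = 1 := by
      rw [← QuotientGroup.mk_pow, ← map_pow]
      exact (QuotientGroup.eq_one_iff _).2 h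
    have h2 : (π b : D ⧸ A) ^ q = 1 := by
      rw [← hi, Subgroup.index_eq_card]
      exact pow_card_eq_one'
    have h3 := Nat.eq_one_of_dvd_coprimes ((hq.coprime_iff_not_dvd).2 hm)
      (orderOf_dvd_of_pow_eq_one h2) (orderOf_dvd_of_pow_eq_one h1)
    exact (QuotientGroup.eq_one_iff _).1 (orderOf_eq_one_iff.1 h3)
  · rw [← pow_mul, mul_comm, ← hs, pow_orderOf_eq_one]

/-- A finite group mapping onto `D` contains a `p`-subgroup mapping onto `A` and a `q`-element outside
the preimage of `A` that normalizes it. This is Frattini's argument for a Sylow `p`-subgroup of the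
preimage of `A`. -/
theorem exists_isPGroup_map_eq_and_mem_normalizer {K : Type*} [Group K] [Finite K] [Fact p.Prime]
    [A.Normal] (hA : IsPGroup p A) (hq : q.Prime) (hi : A.index = q) (π : K →* D)
    (hπ : Function.Surjective π) :
    ∃ (P : Subgroup K) (b : K), IsPGroup p P ∧ P.map π = A ∧ b ∈ Subgroup.normalizer (P : Set K) ∧
      π b ∉ A ∧ ∃ s, b ^ q ^ s = 1 := by
  let M : Subgroup K := A.comap π
  let f : M →* A := π.subgroupComap A
  have hf : Function.Surjective f := π.subgroupComap_surjective_of_surjective A hπ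
  obtain ⟨P⟩ : Nonempty (Sylow p M) := Sylow.nonempty
  have hPf : (P : Subgroup M).map f = ⊤ := by
    rw [← Sylow.coe_mapSurjective hf]
    have h1 : IsPGroup p (⊤ : Subgroup A) := hA.to_subgroup ⊤
    exact (P.mapSurjective hf).3 h1 le_top |>.symm
  have hPπ : ((P : Subgroup M).map M.subtype).map π = A := by
    have : π.comp M.subtype = A.subtype.comp f := rfl
    rw [Subgroup.map_map, this, ← Subgroup.map_map, hPf, ← MonoidHom.range_eq_map,
      Subgroup.range_subtype]
  have hnor := Sylow.normalizer_sup_eq_top P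
  obtain ⟨b, hb, hbA⟩ :
      ∃ b ∈ Subgroup.normalizer (((P : Subgroup M).map M.subtype : Subgroup K) : Set K),
        π b ∉ A := by
    -- If the normalizer lay in the preimage of `A`, that preimage would be everything, whereas it has
    -- index `q`.
    by_contra! hcon
    have hle :
        Subgroup.normalizer (((P : Subgroup M).map M.subtype : Subgroup K) : Set K) ≤ M := hcon
    rw [sup_eq_right.2 hle] at hnor
    refine hq.ne_one ?_
    rw [← hi, ← Subgroup.index_comap_of_surjective A hπ]
    exact Subgroup.index_eq_one.2 hnor
  obtain ⟨b', hb', hb'A, hs⟩ := exists_pow_prime_pow_eq_one_of_notMem hq hi π hb hbA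
  exact ⟨_, b', P.2.map _, hPπ, hb', hb'A, hs⟩

theorem Subgroup.pow_mem_of_mem_sup_zpowers {K : Type*} [Group K] {C : Subgroup K} {b g : K}
    {n : ℕ} (hb : b ∈ normalizer (C : Set K)) (hbn : b ^ n = 1) (hg : g ∈ C ⊔ zpowers b) :
    g ^ n ∈ C := by
  have hle : zpowers b ≤ normalizer (C : Set K) := zpowers_le.2 hb
  rw [← SetLike.mem_coe, coe_mul_of_right_le_normalizer_left _ _ hle] at hg
  obtain ⟨c, hc, _, ⟨j, rfl⟩, rfl⟩ := hg
  have key : ∀ i : ℕ, ∃ c' ∈ C, (c * b ^ j) ^ i = c' * (b ^ j) ^ i := by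
    intro i
    induction i with
    | zero => exact ⟨1, one_mem _, by simp⟩
    | succ i ih =>
      obtain ⟨c', hc', h⟩ := ih
      refine ⟨c' * ((b ^ j) ^ i * c * ((b ^ j) ^ i)⁻¹), mul_mem hc' ?_, ?_⟩
      · exact (mem_normalizer_iff.1 (pow_mem (zpow_mem hb j) i) c).1 hc
      · rw [pow_succ, h]
        group
  obtain ⟨c', hc', h⟩ := key n
  simp only
  rw [h, ← zpow_natCast (b ^ j), ← zpow_mul, mul_comm, zpow_mul, zpow_natCast, hbn, one_zpow, mul_one]
  exact hc'

/-- Let `x` and `b` be such that `b` normalizes `⟨x⟩`, has `q`-power order, and `π x`, `π b` generate `D`.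
If `φ` is injective on `⟨x⟩`, then `π` restricted to `⟨x, b⟩` factors through `φ`: an element of the
kernel of `φ` centralizes `x` and has `q`-power order, so its image under `π` lies in the centralizer
of `A`, which is the `p`-group `A`, and is trivial. -/
theorem isGroupSection_of_zpowers_disjoint_ker {K X : Type*} [Group K] [Finite K] [Group X]
    (hpq : p.Coprime q) (hA : IsPGroup p A) (hAc : IsMulCommutative A) (hq : A.index.Prime)
    (hc : ¬ A ≤ Subgroup.center D) (π : K →* D) (φ : K →* X) {x b : K} {s : ℕ}
    (hx : Subgroup.zpowers (π x) = A) (hb : b ∈ Subgroup.normalizer (Subgroup.zpowers x : Set K))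
    (hbA : π b ∉ A) (hbs : b ^ q ^ s = 1)
    (hφ : ∀ g ∈ Subgroup.zpowers x, φ g = 1 → g = 1) : IsGroupSection D X := by
  let L : Subgroup K := Subgroup.zpowers x ⊔ Subgroup.zpowers b
  have hxL : x ∈ L := Subgroup.mem_sup_left (Subgroup.mem_zpowers x)
  have hbL : b ∈ L := Subgroup.mem_sup_right (Subgroup.mem_zpowers b)
  have hLn : L ≤ Subgroup.normalizer (Subgroup.zpowers x : Set K) :=
    sup_le Subgroup.le_normalizer (Subgroup.zpowers_le.2 hb)
  have hL : L.map π = ⊤ := by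
    refine Subgroup.eq_top_of_lt_of_prime_index hq (lt_of_le_of_ne ?_ fun h => hbA ?_)
    · rw [← hx, Subgroup.zpowers_le]
      exact Subgroup.mem_map_of_mem π hxL
    · rw [h]
      exact Subgroup.mem_map_of_mem π hbL
  refine IsGroupSection.of_ker_le (φ.comp L.subtype) (π.comp L.subtype) (fun d => ?_) ?_
  · obtain ⟨g, hg, rfl⟩ := (hL ▸ Subgroup.mem_top d : d ∈ L.map π)
    exact ⟨⟨g, hg⟩, rfl⟩
  · rintro ⟨g, hg⟩ hgφ
    change φ g = 1 at hgφ
    change π g = 1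
    -- The commutator lies in `⟨x⟩`, which `g` normalizes, and in the kernel of `φ`.
    have hcomm : g * x * g⁻¹ * x⁻¹ = 1 := by
      refine hφ _ (mul_mem ?_ (inv_mem (Subgroup.mem_zpowers x))) (by simp [hgφ])
      exact (Subgroup.mem_normalizer_iff.1 (hLn hg) x).1 (Subgroup.mem_zpowers x)
    have hcomm' : g * x = x * g := by
      rwa [mul_inv_eq_one, mul_inv_eq_iff_eq_mul] at hcomm
    have hgA : π g ∈ A := by
      refine Subgroup.centralizer_le_of_prime_index hq hAc hc ?_
      rw [← hx, Subgroup.mem_centralizer_iff]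
      rintro _ ⟨k, rfl⟩
      have : Commute (π x) (π g) := by
        rw [commute_iff_eq, ← map_mul, ← map_mul, hcomm']
      exact this.zpow_left k
    have hgq : g ^ q ^ s = 1 :=
      hφ _ (Subgroup.pow_mem_of_mem_sup_zpowers hb hbs hg) (by rw [map_pow, hgφ, one_pow])
    obtain ⟨k, hk⟩ := hA ⟨π g, hgA⟩
    have hk' : π g ^ p ^ k = 1 := congrArg Subtype.val hk
    have hk'' : π g ^ q ^ s = 1 := by rw [← map_pow, hgq, map_one]
    exact orderOf_eq_one_iff.1 (Nat.eq_one_of_dvd_coprimes (Nat.Coprime.pow k s hpq)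
      (orderOf_dvd_of_pow_eq_one hk') (orderOf_dvd_of_pow_eq_one hk''))

/-- A homomorphism that does not kill the elements of order `p` of a cyclic `p`-group is injective
on it. -/
theorem eq_one_of_mem_zpowers_of_map_eq_one [Fact p.Prime] {K X : Type*} [Group K] [Group X]
    (φ : K →* X) {x : K} {n : ℕ} (hx : orderOf x = p ^ (n + 1)) (h : φ (x ^ p ^ n) ≠ 1) :
    ∀ g ∈ Subgroup.zpowers x, φ g = 1 → g = 1 := by
  rintro _ ⟨k, rfl⟩ hk
  simp only at hk ⊢
  have h1 : orderOf (φ x) = p ^ (n + 1) := by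
    refine orderOf_eq_prime_pow (by rwa [← map_pow]) ?_
    rw [← map_pow, ← hx, pow_orderOf_eq_one, map_one]
  rw [map_zpow, ← orderOf_dvd_iff_zpow_eq_one, h1, ← hx] at hk
  exact orderOf_dvd_iff_zpow_eq_one.1 hk

/-- A finite group mapping onto `D` contains a cyclic `p`-subgroup `⟨x⟩` mapping onto `A`, normalized by
an element `b` of `q`-power order outside the preimage of `A`. -/
theorem exists_normalizer_zpowers_map_eq {K : Type*} [Group K] [Finite K] [Fact p.Prime]
    [A.Normal] (hA : IsPGroup p A) (hAc : IsCyclic A) (hA1 : A ≠ ⊥) (hq : q.Prime)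
    (hpq : q.Coprime p) (hi : A.index = q) (π : K →* D) (hπ : Function.Surjective π) :
    ∃ x b : K, (∃ n, orderOf x = p ^ (n + 1)) ∧ Subgroup.zpowers (π x) = A ∧
      b ∈ Subgroup.normalizer (Subgroup.zpowers x : Set K) ∧ π b ∉ A ∧ ∃ s, b ^ q ^ s = 1 := by
  obtain ⟨P, b, hP, hPA, hb, hbA, s, hbs⟩ :=
    exists_isPGroup_map_eq_and_mem_normalizer hA hq hi π hπ
  obtain ⟨a, ha⟩ := (Subgroup.isCyclic_iff_exists_zpowers_eq_top A).1 hAc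
  have haA : a ∈ A := ha ▸ Subgroup.mem_zpowers a
  have hDfin : Finite D := Finite.of_surjective π hπ
  obtain ⟨c, hc⟩ : ∃ c : ℕ, π b * a * (π b)⁻¹ = a ^ c := by
    have h1 : π b * a * (π b)⁻¹ ∈ A := Subgroup.Normal.conj_mem ‹_› a haA _
    rw [← ha, ← mem_powers_iff_mem_zpowers] at h1
    obtain ⟨c, hc⟩ := h1
    exact ⟨c, hc.symm⟩
  have hca : ∀ i : ℕ, π b ^ i * a * (π b ^ i)⁻¹ = a ^ c ^ i := by
    intro i
    induction i with
    | zero => simp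
    | succ i ih =>
      calc _ = π b * (π b ^ i * a * (π b ^ i)⁻¹) * (π b)⁻¹ := by group
        _ = _ := by rw [ih, ← conj_pow, hc, ← pow_mul, ← pow_succ']
  have hcN : c ^ q ^ s ≡ 1 [MOD orderOf a] := by
    rw [← pow_eq_pow_iff_modEq, ← hca, ← map_pow, hbs]
    simp
  have hpa : p ∣ orderOf a := by
    have : (⟨a, haA⟩ : A) ≠ 1 := by
      intro h
      have h1 : a = 1 := congrArg Subtype.val h
      rw [h1, Subgroup.zpowers_one_eq_bot] at ha
      exact hA1 ha.symm
    simpa using hA.dvd_orderOf this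
  obtain ⟨e, he⟩ := IsPGroup.iff_card.1 hP
  have hcop : (q ^ s).Coprime p := hpq.pow_left s
  -- Conjugation by `b` is the `c`-th power map on `A`. The exponent is lifted to one of order
  -- dividing `q ^ s` modulo `p ^ (e + 1)`, a multiple of the exponent of `P` divisible by `p`.
  obtain ⟨l, hlc, hl⟩ := Nat.exists_modEq_pow_modEq_one hcop (pow_pos hq.pos s).ne' hpa hcN (e + 1)
  have hconj : ∀ y ∈ A, π b * y * (π b)⁻¹ = y ^ l := by
    intro y hy
    rw [← ha] at hy
    obtain ⟨k, rfl⟩ := hy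
    simp only
    rw [← conj_zpow, hc, ← (pow_eq_pow_iff_modEq.2 hlc), ← zpow_natCast, ← zpow_natCast,
      ← zpow_mul, ← zpow_mul, mul_comm]
  have hbP : ∀ g ∈ P, b * g * b⁻¹ ∈ P := fun g hg => (Subgroup.mem_normalizer_iff.1 hb g).1 hg
  let σ : P →* P := ((MulAut.conj b).toMonoidHom.comp P.subtype).codRestrict P fun g => hbP g g.2
  have hσ : ∀ (i : ℕ) (g : P), ((σ^[i] g : P) : K) = b ^ i * g * (b ^ i)⁻¹ := by
    intro i
    induction i with
    | zero => intro g; simp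
    | succ i ih =>
      intro g
      rw [Function.iterate_succ_apply, ih]
      change b ^ i * (b * g * b⁻¹) * (b ^ i)⁻¹ = _
      group
  have hπP : ∀ g : P, π g ∈ A := fun g => hPA ▸ Subgroup.mem_map_of_mem π g.2
  let _ : CommGroup A := IsCyclic.commGroup
  let ρ : P →* A := (π.comp P.subtype).codRestrict A hπP
  have hu : ∃ u : P, Subgroup.zpowers (ρ u) = ⊤ := by
    obtain ⟨u, hu, hua⟩ : a ∈ P.map π := hPA ▸ haA
    refine ⟨⟨u, hu⟩, eq_top_iff.2 ?_⟩
    rintro ⟨y, hy⟩ -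
    rw [← ha, ← hua] at hy
    obtain ⟨k, rfl⟩ := hy
    exact ⟨k, rfl⟩
  obtain ⟨u, hu⟩ := hu
  obtain ⟨w, ⟨k, hk⟩, hw⟩ := IsPGroup.exists_map_mem_zpowers hcop e.succ_ne_zero hl σ ρ
    (fun g => by rw [pow_succ, pow_mul, ← he, pow_card_eq_one', one_pow])
    (fun g => Subtype.ext (by rw [hσ, hbs]; simp))
    (fun g => Subtype.ext (by
      change π (b * g * b⁻¹) = π g ^ l
      rw [← hconj _ (hπP g)]
      simp)) hu
  have hwA : Subgroup.zpowers (π w) = A := by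
    have h1 := congrArg (Subgroup.map A.subtype) hw
    rw [MonoidHom.map_zpowers, ← MonoidHom.range_eq_map, Subgroup.range_subtype] at h1
    exact h1
  refine ⟨w, b, ?_, hwA, ?_, hbA, s, hbs⟩
  · obtain ⟨n, hn⟩ := IsPGroup.iff_orderOf.1 hP w
    rw [Subgroup.orderOf_coe]
    rcases n with _ | n
    · exfalso
      rw [pow_zero, orderOf_eq_one_iff] at hn
      rw [hn] at hwA
      exact hA1 (by simpa using hwA.symm)
    · exact ⟨n, hn⟩
  · have hk' : (w : K) ^ k = b * w * b⁻¹ := congrArg Subtype.val hk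
    rw [Subgroup.mem_normalizer_iff_map_conj_eq]
    apply Subgroup.eq_of_le_of_card_ge
    · rw [MonoidHom.map_zpowers, Subgroup.zpowers_le]
      exact ⟨k, hk'⟩
    · exact (Subgroup.card_map_of_injective (MulAut.conj b).injective).ge

/-- If a finite group `K` mapping onto `D` is residually `𝔛`, then `D` is a section of a member of `𝔛`:
a homomorphism that does not kill the socle of the cyclic `p`-group `⟨x⟩` suffices. -/
theorem exists_isGroupSection_of_separating {K : Type*} [Group K] [Finite K] [A.Normal]
    (hp : p.Prime) (hq : q.Prime) (hpq : p ≠ q) (hA : IsPGroup p A) (hAc : IsCyclic A)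
    (hi : A.index = q) (hc : ¬ A ≤ Subgroup.center D) (π : K →* D) (hπ : Function.Surjective π)
    (𝔛 : Set GrpCat.{u}) (h : ∀ g : K, g ≠ 1 → ∃ X ∈ 𝔛, ∃ φ : K →* X, φ g ≠ 1) :
    ∃ X ∈ 𝔛, IsGroupSection D X := by
  have : Fact p.Prime := ⟨hp⟩
  have hcop : p.Coprime q := (Nat.coprime_primes hp hq).2 hpq
  obtain ⟨x, b, ⟨n, hn⟩, hx, hb, hbA, s, hbs⟩ := exists_normalizer_zpowers_map_eq hA hAc
    (fun h0 => hc (h0 ▸ bot_le)) hq hcop.symm hi π hπ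
  obtain ⟨X, hX, φ, hφ⟩ := h (x ^ p ^ n) (by
    refine pow_ne_one_of_lt_orderOf (pow_pos hp.pos n).ne' ?_
    rw [hn]
    exact Nat.pow_lt_pow_right hp.one_lt n.lt_succ_self)
  exact ⟨X, hX, isGroupSection_of_zpowers_disjoint_ker hcop hA inferInstance (hi ▸ hq) hc π φ hx hb
    hbA hbs (eq_one_of_mem_zpowers_of_map_eq_one φ hn hφ)⟩

end

/-! ### Free groups of the generated variety -/

/-- The elements of the free group on `S` killed by every homomorphism to a member of `𝔛`;
the quotient by this subgroup is the free group on `S` of the variety generated by `𝔛`. -/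
def verbalKernel (S : Type u) (𝔛 : Set GrpCat.{u}) : Subgroup (FreeGroup S) :=
  ⨅ X ∈ 𝔛, ⨅ f : FreeGroup S →* X, f.ker

theorem mem_verbalKernel {S : Type u} {𝔛 : Set GrpCat.{u}} {w : FreeGroup S} :
    w ∈ verbalKernel S 𝔛 ↔ ∀ X ∈ 𝔛, ∀ f : FreeGroup S →* X, f w = 1 := by
  simp [verbalKernel, Subgroup.mem_iInf, MonoidHom.mem_ker]

instance (S : Type u) (𝔛 : Set GrpCat.{u}) : (verbalKernel S 𝔛).Normal :=
  ⟨fun w hw g => mem_verbalKernel.2 fun X hX f => by simp [mem_verbalKernel.1 hw X hX f]⟩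

/-- The quotient by the verbal kernel satisfies the laws of `𝔛`: a substitution of elements of the
quotient into a law lifts to the free group, where each map to a member of `𝔛` sends it to `1`. -/
theorem quotient_verbalKernel_mem (S : Type u) (𝔛 : Set GrpCat.{u}) :
    GrpCat.of (FreeGroup S ⧸ verbalKernel S 𝔛) ∈ generatedGroupVariety 𝔛 := by
  rintro _ ⟨⟨W, rfl⟩, h⟩ w hw x
  choose y hy using fun i => QuotientGroup.mk'_surjective (verbalKernel S 𝔛) (x i)
  have h1 : FreeGroup.lift x = (QuotientGroup.mk' (verbalKernel S 𝔛)).comp (FreeGroup.lift y) :=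
    FreeGroup.ext_hom _ _ fun i => by simp [← hy]
  rw [h1]
  refine (QuotientGroup.eq_one_iff _).2 (mem_verbalKernel.2 fun X hX f => ?_)
  have h2 : FreeGroup.lift (fun i => f (y i)) = f.comp (FreeGroup.lift y) :=
    FreeGroup.ext_hom _ _ fun i => by simp
  have h3 := h hX w hw fun i => f (y i)
  rwa [h2] at h3

/-- A countable `D` in the variety generated by `𝔛` is a quotient of the free group on the set `D` in
that variety. Countability serves to rename the free generators as variables indexed by `ℕ`. -/
theorem lift_id_eq_one_of_mem_verbalKernel {D : Type u} [Group D] [Countable D]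
    {𝔛 : Set GrpCat.{u}} (hD : GrpCat.of D ∈ generatedGroupVariety 𝔛) {w : FreeGroup D}
    (hw : w ∈ verbalKernel D 𝔛) : FreeGroup.lift id w = 1 := by
  obtain ⟨e, he⟩ := exists_injective_nat D
  have hlaw : ∀ X ∈ 𝔛, IsGroupLaw (FreeGroup.map e w) X := fun X hX x => by
    have h1 : (FreeGroup.lift x).comp (FreeGroup.map e) = FreeGroup.lift (x ∘ e) :=
      FreeGroup.ext_hom _ _ fun i => by simp
    exact (DFunLike.congr_fun h1 w).trans (mem_verbalKernel.1 hw X hX _)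
  have hDw : IsGroupLaw (FreeGroup.map e w) D :=
    hD {G | ∀ v ∈ ({FreeGroup.map e w} : Set _), IsGroupLaw v G}
      ⟨⟨_, rfl⟩, fun X hX v hv => hv ▸ hlaw X hX⟩ _ rfl
  have h2 : (FreeGroup.lift (Function.invFun e)).comp (FreeGroup.map e) = FreeGroup.lift id :=
    FreeGroup.ext_hom _ _ fun i => by simp [Function.leftInverse_invFun he i]
  rw [← h2]
  exact hDw _

theorem finite_quotient_verbalKernel {S : Type u} [Finite S] {𝔛 : Set GrpCat.{u}}
    (h : 𝔛.Finite) (hX : ∀ X ∈ 𝔛, Finite X) : Finite (FreeGroup S ⧸ verbalKernel S 𝔛) := by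
  have : Finite 𝔛 := h
  have : ∀ X : 𝔛, Finite X.1 := fun X => hX X X.2
  have : ∀ X : 𝔛, Finite (FreeGroup S →* X.1) := fun X => Finite.of_equiv _ FreeGroup.lift
  let Φ : FreeGroup S →* ∀ (X : 𝔛), (FreeGroup S →* X.1) → X.1 :=
    MonoidHom.pi fun X => MonoidHom.pi fun f => f
  have hΦ : Φ.ker = verbalKernel S 𝔛 := by
    ext w
    rw [MonoidHom.mem_ker, mem_verbalKernel, funext_iff, Subtype.forall]
    exact forall₂_congr fun X hX => funext_iff
  rw [← hΦ]
  exact Finite.of_injective _ (QuotientGroup.kerLift_injective Φ)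

/-! ### Groups in the generated variety as sections -/

theorem mainTheorem2 (p q : ℕ) (hp : p.Prime) (hq : q.Prime) (hpq : p ≠ q)
    (D : Type u) [Group D] (A B : Subgroup D) (hAn : A.Normal) (hAB : A.IsComplement' B)
    (hAc : IsCyclic A) (hAp : IsPGroup p A) (hB : Nat.card B = q) (hcomm : ⁅A, B⁆ ≠ ⊥)
    (𝔛 : Set GrpCat.{u}) :
    (IsLocallyFiniteGroupClass (generatedGroupVariety 𝔛) →
      GrpCat.of D ∈ generatedGroupVariety 𝔛 →
        ∃ X ∈ 𝔛, IsGroupSection D X) ∧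
    (𝔛.Finite → (∀ X ∈ 𝔛, Finite X) →
      GrpCat.of D ∈ generatedGroupVariety 𝔛 →
        ∃ X ∈ 𝔛, IsGroupSection D X) := by
  have hi : A.index = q := hAB.symm.index_eq_card.trans hB
  have hc : ¬ A ≤ Subgroup.center D := fun h => hcomm <| by
    rw [Subgroup.commutator_eq_bot_iff_le_centralizer]
    exact h.trans (Subgroup.center_le_centralizer _)
  have hDfin : Finite D := by
    obtain ⟨a, ha⟩ := hAc.exists_generator
    refine Nat.finite_of_card_ne_zero ?_
    rw [← hAB.card_mul_card, hB, ← orderOf_eq_card_of_forall_mem_zpowers ha]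
    exact mul_ne_zero (hAp.isOfFinOrder hp.ne_zero a).orderOf_pos.ne' hq.ne_zero
  have main : Finite (FreeGroup D ⧸ verbalKernel D 𝔛) →
      GrpCat.of D ∈ generatedGroupVariety 𝔛 → ∃ X ∈ 𝔛, IsGroupSection D X := by
    intro hfin hD
    refine exists_isGroupSection_of_separating hp hq hpq hAp hAc hi hc
      (QuotientGroup.lift (verbalKernel D 𝔛) (FreeGroup.lift id)
        fun w hw => lift_id_eq_one_of_mem_verbalKernel hD hw)
      (fun d => ⟨(FreeGroup.of d : FreeGroup D), FreeGroup.lift_apply_of⟩) 𝔛 fun g => ?_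
    obtain ⟨w, rfl⟩ := QuotientGroup.mk_surjective g
    intro hg
    rw [Ne, QuotientGroup.eq_one_iff, mem_verbalKernel] at hg
    push Not at hg
    obtain ⟨X, hX, f, hf⟩ := hg
    exact ⟨X, hX, QuotientGroup.lift _ f fun v hv => mem_verbalKernel.1 hv X hX f, hf⟩
  refine ⟨fun hlf => main ?_, fun hX hXf => main (finite_quotient_verbalKernel hX hXf)⟩
  exact hlf _ (quotient_verbalKernel_mem D 𝔛)
    (Group.fg_of_surjective (QuotientGroup.mk'_surjective (verbalKernel D 𝔛)))
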